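/- For $x\in\mathbb C^n$ let $x^*_1\ge x^*_2\ge\dots\ge x^*_n$ be the non-increasing rearrangement of $|x_1|,\dots,|x_n|$, with $x^*_m:=0$ for $m>n$. For an $n\times n$ complex matrix $M$ and $I\subset[n]$, let $M_{I'}$ be the $n\times(n-|I|)$ submatrix formed by the columns of $M$ with indices in $[n]\setminus I$. All norms of vectors are Euclidean, and $\|\cdot\|$ of a matrix is the operator norm between Euclidean spaces. There are universal constants $\tilde c,c,\hat c,C>0$ with the following property. Let $n,k$ be non-negative integers, let $\eta,\rho>0$ with $\lfloor\eta n\rfloor\ge1$, and let $s,t\ge0$. Let $\mathcal V$ be the set of all $k\times n$ complex matrices $V$ with orthonormal rows such that $(\mathrm{row}_j(V))^*_{\lfloor\eta n\rfloor}\ge\rho/\sqrt n$ for all $j\in[k]$. Let $B$ be a random $n\times n$ complex matrix with independent columns, and let $$\ell:=\lfloor\tilde c\,\eta^3\rho^2k\rfloor .$$ For $I\subset[n]$ denote by $P_I$ the orthogonal projection of $\mathbb C^n$ whose kernel is the linear span of $\mathrm{col}_j(B)$, $j\in[n]\setminus I$. For every $\ell$-element subset $I\subset[n]$ let $\mathcal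 F_\ell(I)$ be a Borel set of complex $n\times(n-\ell)$ matrices with columns indexed by $[n]\setminus I$. Assume that for every $\ell$-element $I\subset[n]$ and every $j\in I$, almost surely on the event $\{B_{I'}\in\mathcal F_\ell(I)\}$, $$\mathbb P\Big\{\|P_I\,\mathrm{col}_j(B)\|_2\le\frac{\sqrt2}{c\,\rho}\sqrt{\frac{n}{\eta k}}\;s\ \Big|\ B_{I'}\Big\}\le t .$$ Let $J$ be uniformly distributed among the $\ell$-element subsets of $[n]$, and let $$\mathcal F_\ell:=\Big\{M\in\mathbb C^{n\times n}:\ \mathbb P_J\{M_{J'}\notin\mathcal F_\ell(J)\}\le(\hat c\,\eta/2)^\ell\Big\}.$$ Then $$\mathbb P\big\{\exists V\in\mathcal V:\ \|BV^\top\|\le s\ \text{ and }\ B\in\mathcal F_\ell\big\}\le\Big(\frac{C\sqrt t}{\eta}\Big)^\ell .$$ (When $k=0$ one has $\ell=0$, and the assumption on small-ball probabilities is void.) -/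

import Mathlib

open MeasureTheory ProbabilityTheory
open scoped Matrix Matrix.Norms.L2Operator

noncomputable section

/-- Complex matrices carry the product (equivalently, for finite index types, the Borel)
σ-algebra of their entries. -/
instance matrixMeasurableSpace (m n : Type*) : MeasurableSpace (Matrix m n ℂ) :=
  MeasurableSpace.pi

/-- The non-increasing rearrangement `x*` of the vector of absolute values of `x`. -/
def rearrangement {n : ℕ} (x : Fin n → ℂ) : Fin n → ℝ :=
  fun i => ‖x (Tuple.sort (fun j => -‖x j‖) i)‖

/-- The order statistic `x*_m`, the `m`-th largest among the absolute values of the coordinates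
of `x`. The index `m` starts from `1`, and `x*_m = 0` when `m > n`. -/
def orderStat {n : ℕ} (x : Fin n → ℂ) (m : ℕ) : ℝ :=
  if h : m - 1 < n then rearrangement x ⟨m - 1, h⟩ else 0

/-- The set of all `k × n` complex matrices `V` with orthonormal rows (in the standard Hermitian
inner product) such that `(row_j V)*_{⌊ηn⌋} ≥ ρ / √n` for every `j`. -/
def spreadMatrices (k n : ℕ) (η ρ : ℝ) : Set (Matrix (Fin k) (Fin n) ℂ) :=
  {V | Orthonormal ℂ (fun j : Fin k => (WithLp.toLp 2 (V.row j) : EuclideanSpace ℂ (Fin n))) ∧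
    ∀ j : Fin k, ρ / √(n : ℝ) ≤ orderStat (V.row j) ⌊η * n⌋₊}

/-- The `j`-th column of a matrix, as a vector of the Hermitian space `ℂⁿ`. -/
def colVec {n : ℕ} (M : Matrix (Fin n) (Fin n) ℂ) (j : Fin n) : EuclideanSpace ℂ (Fin n) :=
  WithLp.toLp 2 (M.col j)

/-- The submatrix of `M` formed by the columns with indices outside `I`. -/
def complCols {n : ℕ} (I : Finset (Fin n)) (M : Matrix (Fin n) (Fin n) ℂ) :
    Matrix (Fin n) {j : Fin n // j ∉ I} ℂ :=
  M.submatrix id Subtype.val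

/-- The linear span of the columns of `M` with indices outside `I`. -/
def complSpan {n : ℕ} (I : Finset (Fin n)) (M : Matrix (Fin n) (Fin n) ℂ) :
    Submodule ℂ (EuclideanSpace ℂ (Fin n)) :=
  Submodule.span ℂ {v | ∃ j, j ∉ I ∧ v = colVec M j}

/-- The orthogonal projection of `ℂⁿ` whose kernel is the linear span of the columns of `M` with
indices outside `I`. -/
def colProj {n : ℕ} (I : Finset (Fin n)) (M : Matrix (Fin n) (Fin n) ℂ) :
    EuclideanSpace ℂ (Fin n) →L[ℂ] EuclideanSpace ℂ (Fin n) :=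
  ((complSpan I M)ᗮ).starProjection

/-- For `J` uniformly distributed among the `l`-element subsets of the index set, the probability
that the submatrix of `M` formed by the columns outside `J` does not belong to `F J`. -/
def exceptionalProb {n : ℕ} (l : ℕ)
    (F : (I : Finset (Fin n)) → Set (Matrix (Fin n) {j : Fin n // j ∉ I} ℂ))
    (M : Matrix (Fin n) (Fin n) ℂ) : ℝ :=
  ({J : Finset (Fin n) | J.card = l ∧ complCols J M ∉ F J}.ncard : ℝ) / (n.choose l : ℝ)

end

/-! Let `v i` be the columns of `V`, and let `u` be the component of `v j` orthogonal to the other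
`v i`, `i ∈ I`. Applying `B * Vᵀ` to the conjugate of `u` gives the combination of the columns of
`B` with coefficients `⟨u, v i⟩`. The projection `P_I` kills the columns outside `I`, and
orthogonality kills those in `I` other than `j`, so `‖P_I col_j B‖ * ‖u‖ ≤ ‖B * Vᵀ‖`
(`norm_colProj_mul_norm_orthComponent_le`). Wherever `u` is not small, column `j` of `B` is short.

A randomized restricted invertibility principle (`restricted_invertibility_card`) shows that for a
proportion at least `(η/16)^l` of the `l`-sets `I`, at least half of the `j ∈ I` have `u` large.
Discarding the exceptional sets leaves a proportion `(η/32)^l` for which `B` lies in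
`manyShortColumns`. This event does not mention `V`, so no net over the spread matrices is needed.
Independence of the columns and a union bound over the half-sets give it probability at most
`(2√t)^l` (`measure_manyShortColumns_le`), and Markov's inequality over `I` divides this by
`(η/32)^l`. -/

/-! ### Restricted invertibility for Bessel systems -/

/-- The sum of squared norms of the projections of a Bessel system onto a span of `K` vectors. -/
theorem sum_norm_sq_starProjection_span_le {ι κ E : Type*} [Fintype ι] [NormedAddCommGroup E]
    [InnerProductSpace ℂ E] [FiniteDimensional ℂ E] (v : ι → E)
    (hv : ∀ u : E, ∑ i, ‖inner ℂ u (v i)‖ ^ 2 ≤ ‖u‖ ^ 2) (K : Finset κ) (w : κ → E) :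
    ∑ i, ‖(Submodule.span ℂ (w '' K)).starProjection (v i)‖ ^ 2 ≤ K.card := by
  set U := Submodule.span ℂ (w '' K)
  have hdim : Module.finrank ℂ U ≤ K.card := by
    classical
    have := finrank_span_finset_le_card (R := ℂ) (K.image w)
    rw [Finset.coe_image] at this
    exact this.trans Finset.card_image_le
  let b := stdOrthonormalBasis ℂ U
  have h1 : ∀ x : E, ‖U.starProjection x‖ ^ 2 = ∑ a, ‖inner ℂ (b a : E) x‖ ^ 2 := by
    intro x
    have : ‖U.starProjection x‖ = ‖U.orthogonalProjectionOnto x‖ := rfl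
    rw [this, ← b.sum_sq_norm_inner_right]
    refine Finset.sum_congr rfl fun a _ => ?_
    rw [Submodule.inner_orthogonalProjectionOnto_eq_of_mem_left]
  simp_rw [h1]
  -- After the swap, the Bessel bound is applied to each unit vector of a basis of the span.
  rw [Finset.sum_comm]
  calc _ ≤ ∑ a, ‖(b a : E)‖ ^ 2 := Finset.sum_le_sum fun a _ => hv _
    _ = Module.finrank ℂ U := by
      have : ∀ a, ‖(b a : E)‖ = 1 := fun a => b.orthonormal.1 a
      simp [this]
    _ ≤ K.card := by exact_mod_cast hdim

/-- Choosing a subset and a point of it is choosing a point outside a smaller subset. -/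
theorem sum_powersetCard_erase {ι : Type*} [DecidableEq ι] (S : Finset ι) (l : ℕ)
    (f : Finset ι → ι → ℝ) :
    ∑ I ∈ S.powersetCard (l + 1), ∑ j ∈ I, f (I.erase j) j
      = ∑ K ∈ S.powersetCard l, ∑ j ∈ S \ K, f K j := by
  rw [Finset.sum_sigma', Finset.sum_sigma']
  refine Finset.sum_bij' (fun x _ => ⟨x.1.erase x.2, x.2⟩) (fun x _ => ⟨insert x.2 x.1, x.2⟩)
    ?_ ?_ ?_ ?_ ?_
  · rintro ⟨I, j⟩ h
    simp only [Finset.mem_sigma, Finset.mem_powersetCard, Finset.mem_sdiff] at h ⊢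
    refine ⟨⟨(Finset.erase_subset _ _).trans h.1.1, ?_⟩, h.1.1 h.2, by simp⟩
    rw [Finset.card_erase_of_mem h.2, h.1.2]; rfl
  · rintro ⟨K, j⟩ h
    simp only [Finset.mem_sigma, Finset.mem_powersetCard, Finset.mem_sdiff] at h ⊢
    refine ⟨⟨Finset.insert_subset h.2.1 h.1.1, ?_⟩, by simp⟩
    rw [Finset.card_insert_of_notMem h.2.2, h.1.2]
  · rintro ⟨I, j⟩ h
    simp only [Finset.mem_sigma] at h
    simp [Finset.insert_erase h.2]
  · rintro ⟨K, j⟩ h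
    simp only [Finset.mem_sigma, Finset.mem_sdiff] at h
    simp [Finset.erase_insert h.2.2]
  · rintro ⟨I, j⟩ _
    rfl

/-- The component of `v j` orthogonal to the other vectors with indices in `I`. -/
noncomputable def orthComponent {ι E : Type*} [DecidableEq ι] [NormedAddCommGroup E]
    [InnerProductSpace ℂ E] [FiniteDimensional ℂ E] (v : ι → E) (I : Finset ι) (j : ι) : E :=
  (Submodule.span ℂ (v '' (I.erase j : Finset ι)))ᗮ.starProjection (v j)

/-- The indices `j ∈ I` for which `v j` is far from the span of the other vectors. -/
noncomputable def farIndices {ι E : Type*} [DecidableEq ι] [NormedAddCommGroup E]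
    [InnerProductSpace ℂ E] [FiniteDimensional ℂ E] (v : ι → E) (τ : ℝ) (I : Finset ι) :
    Finset ι :=
  open Classical in I.filter fun j => τ ≤ ‖orthComponent v I j‖ ^ 2

/-- An average over pairs `j ∈ I`: removing `j` turns the sum of squared projections into a sum over
`l`-sets `K` and points outside `K`, and the Bessel bound gives at most `l` for each `K`. An index
that is not far contributes more than `τ`, so few sets have a majority of such indices. -/
theorem half_choose_le_card_farIndices {ι E : Type*} [Fintype ι] [DecidableEq ι]
    [NormedAddCommGroup E] [InnerProductSpace ℂ E] [FiniteDimensional ℂ E] (v : ι → E)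
    (hv : ∀ u : E, ∑ i, ‖inner ℂ u (v i)‖ ^ 2 ≤ ‖u‖ ^ 2) (S : Finset ι) {τ : ℝ} (hτ : 0 < τ)
    (hS : ∀ i ∈ S, 2 * τ ≤ ‖v i‖ ^ 2) (l : ℕ) (hl : l + 1 ≤ S.card)
    (hlS : 4 * (l : ℝ) ≤ τ * (S.card - l)) :
    (S.card.choose (l + 1) : ℝ) / 2 ≤
      ((S.powersetCard (l + 1)).filter
        fun I => l + 1 ≤ 2 * (farIndices v τ I).card).card := by
  classical
  have key : ∑ I ∈ S.powersetCard (l + 1),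
      ((I.filter fun j => ¬ τ ≤ ‖orthComponent v I j‖ ^ 2).card : ℝ) * τ
        ≤ S.card.choose l * l := by
    calc _ ≤ ∑ I ∈ S.powersetCard (l + 1), ∑ j ∈ I,
          ‖(Submodule.span ℂ (v '' (I.erase j : Finset ι))).starProjection (v j)‖ ^ 2 := by
          refine Finset.sum_le_sum fun I hI => ?_
          rw [← nsmul_eq_mul, ← Finset.sum_const]
          refine (Finset.sum_le_sum fun j hj => ?_).trans
            (Finset.sum_le_sum_of_subset_of_nonneg (Finset.filter_subset _ _)
              fun _ _ _ => by positivity)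
          rw [Finset.mem_filter] at hj
          have h1 := hS j ((Finset.mem_powersetCard.1 hI).1 hj.1)
          have h2 := Submodule.norm_sq_eq_add_norm_sq_starProjection (v j)
            (Submodule.span ℂ (v '' (I.erase j : Finset ι)))
          have h3 := hj.2
          rw [orthComponent] at h3
          linarith
      _ = ∑ K ∈ S.powersetCard l, ∑ j ∈ S \ K,
          ‖(Submodule.span ℂ (v '' (K : Finset ι))).starProjection (v j)‖ ^ 2 :=
          sum_powersetCard_erase S l fun K j =>
            ‖(Submodule.span ℂ (v '' (K : Finset ι))).starProjection (v j)‖ ^ 2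
      _ ≤ ∑ K ∈ S.powersetCard l, (l : ℝ) := by
          refine Finset.sum_le_sum fun K hK => ?_
          rw [← (Finset.mem_powersetCard.1 hK).2]
          exact (Finset.sum_le_univ_sum_of_nonneg fun _ => by positivity).trans
            (sum_norm_sq_starProjection_span_le v hv K v)
      _ = _ := by simp
  set N := ((S.powersetCard (l + 1)).filter fun I => l + 1 ≤ 2 * (farIndices v τ I).card).card
  set N' := ((S.powersetCard (l + 1)).filter fun I => ¬ l + 1 ≤ 2 * (farIndices v τ I).card).card
  have hNN : N + N' = S.card.choose (l + 1) := by
    rw [← Finset.card_powersetCard]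
    exact Finset.card_filter_add_card_filter_not _
  have h4 : (N' : ℝ) * ((l + 1) / 2 * τ) ≤ S.card.choose l * l := by
    refine le_trans ?_ key
    rw [← nsmul_eq_mul, ← Finset.sum_const]
    refine (Finset.sum_le_sum fun I hI => ?_).trans
      (Finset.sum_le_sum_of_subset_of_nonneg (Finset.filter_subset _ _)
        fun _ _ _ => by positivity)
    rw [Finset.mem_filter, Finset.mem_powersetCard] at hI
    refine mul_le_mul_of_nonneg_right ?_ hτ.le
    have h5 : (farIndices v τ I).card +
        (I.filter fun j => ¬ τ ≤ ‖orthComponent v I j‖ ^ 2).card = l + 1 := by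
      rw [← hI.1.2, farIndices]
      exact Finset.card_filter_add_card_filter_not _
    have h6 : l + 1 ≤ 2 * (I.filter fun j => ¬ τ ≤ ‖orthComponent v I j‖ ^ 2).card := by omega
    have h7 : ((l : ℝ) + 1) ≤ 2 * (I.filter fun j => ¬ τ ≤ ‖orthComponent v I j‖ ^ 2).card := by
      exact_mod_cast h6
    linarith
  have hch : (S.card.choose (l + 1) : ℝ) * (l + 1) = S.card.choose l * (S.card - l) := by
    have := Nat.choose_succ_right_eq S.card l
    have h8 : ((S.card - l : ℕ) : ℝ) = (S.card : ℝ) - l := by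
      rw [Nat.cast_sub (by omega)]
    rw [← h8]
    exact_mod_cast this
  have hSl : (0 : ℝ) < S.card - l := by
    have : ((l : ℝ) + 1) ≤ S.card := by exact_mod_cast hl
    linarith
  have h9 : (N' : ℝ) ≤ S.card.choose (l + 1) / 2 := by
    have h10 : (N' : ℝ) * ((l + 1) / 2 * τ) * (S.card - l)
        ≤ S.card.choose (l + 1) / 2 * ((l + 1) / 2 * τ) * (S.card - l) := by
      calc _ ≤ (S.card.choose l * l : ℝ) * (S.card - l) :=
            mul_le_mul_of_nonneg_right h4 hSl.le
        _ = S.card.choose (l + 1) * (l + 1) * l := by rw [hch]; ring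
        _ ≤ S.card.choose (l + 1) * (l + 1) * (τ * (S.card - l) / 4) := by
            refine mul_le_mul_of_nonneg_left ?_ (by positivity)
            linarith
        _ = _ := by ring
    exact le_of_mul_le_mul_right (le_of_mul_le_mul_right h10 hSl) (by positivity)
  have h11 : (N : ℝ) + N' = S.card.choose (l + 1) := by exact_mod_cast hNN
  linarith

/-! ### Order statistics and spread matrices -/

/-- Compare falling factorials: that of `s` is at least `(s + 1 - l)^l`, that of `n` at most `n^l`.
-/
theorem pow_mul_choose_le_choose {s n l : ℕ} {a : ℝ} (ha : 0 ≤ a) (hn : 0 < n)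
    (h : a * n ≤ s + 1 - l) : a ^ l * n.choose l ≤ s.choose l := by
  have hls : l ≤ s + 1 := by
    have : (0 : ℝ) ≤ s + 1 - l := le_trans (by positivity) h
    have : (l : ℝ) ≤ s + 1 := by linarith
    exact_mod_cast this
  have h1 : ((s + 1 - l : ℕ) : ℝ) = s + 1 - l := by
    rw [Nat.cast_sub hls]; push_cast; ring
  have h2 : ((s + 1 - l : ℕ) : ℝ) ^ l ≤ s.descFactorial l := by
    exact_mod_cast Nat.pow_sub_le_descFactorial s l
  have h3 : (n.descFactorial l : ℝ) ≤ (n : ℝ) ^ l := by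
    exact_mod_cast Nat.descFactorial_le_pow n l
  rw [h1] at h2
  have h4 : (a * n) ^ l ≤ (s + 1 - l : ℝ) ^ l := pow_le_pow_left₀ (by positivity) h l
  rw [Nat.descFactorial_eq_factorial_mul_choose] at h2 h3
  push_cast at h2 h3
  have h5 : (0 : ℝ) < l.factorial := by exact_mod_cast l.factorial_pos
  refine le_of_mul_le_mul_left ?_ h5
  calc (l.factorial : ℝ) * (a ^ l * n.choose l) = a ^ l * (l.factorial * n.choose l) := by ring
    _ ≤ a ^ l * n ^ l := by gcongr
    _ ≤ _ := by rw [← mul_pow]; exact h4.trans h2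

theorem le_card_of_le_orderStat {n m : ℕ} (x : Fin n → ℂ) {a : ℝ} (ha : 0 < a)
    (hm : 1 ≤ m) (h : a ≤ orderStat x m) :
    m ≤ (Finset.univ.filter fun i => a ≤ ‖x i‖).card := by
  unfold orderStat at h
  split_ifs at h with hmn
  · have hmono : ∀ i : Fin n, i ≤ ⟨m - 1, hmn⟩ → a ≤ rearrangement x i := by
      intro i hi
      refine h.trans ?_
      have := Tuple.monotone_sort (fun j => -‖x j‖) hi
      simpa [rearrangement] using this
    have : (Finset.Iic (⟨m - 1, hmn⟩ : Fin n)).card ≤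
        (Finset.univ.filter fun i => a ≤ ‖x i‖).card := by
      refine Finset.card_le_card_of_injOn (Tuple.sort (fun j => -‖x j‖)) ?_
        (Equiv.injective _).injOn
      intro i hi
      simpa [rearrangement] using hmono i (by simpa using hi)
    rw [Fin.card_Iic] at this
    simpa [Nat.sub_add_cancel hm] using this
  -- Here `m > n`, and the default value `0` contradicts `0 < a`.
  · linarith

theorem le_of_pos_orderStat {n m : ℕ} (x : Fin n → ℂ) (hm : 1 ≤ m) (h : 0 < orderStat x m) :
    m ≤ n := by
  unfold orderStat at h
  split_ifs at h with hmn
  · omega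
  · exact absurd h (lt_irrefl _)

/-- The columns of a matrix with orthonormal rows form a Parseval frame. -/
theorem sum_norm_sq_inner_col_of_orthonormal_row {k n : ℕ} (V : Matrix (Fin k) (Fin n) ℂ)
    (hV : Orthonormal ℂ (fun j : Fin k => (WithLp.toLp 2 (V.row j) : EuclideanSpace ℂ (Fin n))))
    (u : EuclideanSpace ℂ (Fin k)) :
    ∑ i, ‖inner ℂ u (WithLp.toLp 2 (V.col i) : EuclideanSpace ℂ (Fin k))‖ ^ 2 = ‖u‖ ^ 2 := by
  -- With conjugated coefficients, the `i`-th entry of the combination of rows is `⟨u, col i⟩`.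
  have h := hV.inner_sum (fun j => star (u j)) (fun j => star (u j)) Finset.univ
  rw [inner_self_eq_norm_sq_to_K, ← RCLike.ofReal_pow, EuclideanSpace.norm_sq_eq] at h
  have h2 : ∀ i, ‖(∑ j, star (u j) • (WithLp.toLp 2 (V.row j) : EuclideanSpace ℂ (Fin n))) i‖
      = ‖inner ℂ u (WithLp.toLp 2 (V.col i) : EuclideanSpace ℂ (Fin k))‖ := by
    intro i
    simp [PiLp.inner_apply, mul_comm]
  rw [EuclideanSpace.norm_sq_eq]
  have h3 : ∀ z : ℂ, (starRingEnd ℂ) (star z) * star z = ((‖z‖ ^ 2 : ℝ) : ℂ) := by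
    intro z
    rw [← Complex.normSq_eq_norm_sq, Complex.normSq_eq_conj_mul_self, starRingEnd_apply, star_star,
      starRingEnd_apply, mul_comm]
  simp_rw [h3] at h
  simp_rw [← h2]
  rw [← Complex.ofReal_sum] at h
  exact Complex.ofReal_injective h

theorem mul_orderStat_sq_le {n m : ℕ} (x : Fin n → ℂ) {a : ℝ} (ha : 0 < a) (hm : 1 ≤ m)
    (h : a ≤ orderStat x m) : m * a ^ 2 ≤ ∑ i, ‖x i‖ ^ 2 := by
  have h1 := le_card_of_le_orderStat x ha hm h
  calc (m : ℝ) * a ^ 2 ≤ (Finset.univ.filter fun i => a ≤ ‖x i‖).card * a ^ 2 := by gcongr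
    _ = ∑ i ∈ Finset.univ.filter fun i => a ≤ ‖x i‖, a ^ 2 := by simp
    _ ≤ ∑ i ∈ Finset.univ.filter fun i => a ≤ ‖x i‖, ‖x i‖ ^ 2 :=
      Finset.sum_le_sum fun i hi => by
        have := (Finset.mem_filter.1 hi).2
        gcongr
    _ ≤ _ := Finset.sum_le_univ_sum_of_nonneg fun _ => by positivity

/-- A matrix whose rows are spread has many columns of large norm. -/
theorem mul_div_le_card_large_columns {k n m : ℕ} (V : Matrix (Fin k) (Fin n) ℂ) {a η : ℝ}
    (ha : 0 < a) (hk : 0 < k) (hm : 1 ≤ m) (h : ∀ j, a ≤ orderStat (V.row j) m) (hη : 0 ≤ η)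
    (hmη : η * n ≤ 2 * m) :
    η * n / 4 ≤ (Finset.univ.filter fun i : Fin n => η * k * a ^ 2 / 4 ≤
      ‖(WithLp.toLp 2 (V.col i) : EuclideanSpace ℂ (Fin k))‖ ^ 2).card := by
  set S := Finset.univ.filter fun i : Fin n => η * k * a ^ 2 / 4 ≤
      ‖(WithLp.toLp 2 (V.col i) : EuclideanSpace ℂ (Fin k))‖ ^ 2 with hS
  -- Double counting of large entries: the rows give at least `k * m ≥ k * η * n / 2` of them.
  -- Columns outside `S` hold at most `η * k / 4` each, columns in `S` at most `k`.
  let N : Fin n → ℕ := fun i => (Finset.univ.filter fun j : Fin k => a ≤ ‖V j i‖).card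
  have hN1 : ∀ i, (N i : ℝ) ≤ k := fun i => by
    have : N i ≤ k := (Finset.card_le_univ _).trans (by simp)
    exact_mod_cast this
  have hN2 : ∀ i, i ∉ S → (N i : ℝ) ≤ η * k / 4 := by
    intro i hi
    have h1 : ‖(WithLp.toLp 2 (V.col i) : EuclideanSpace ℂ (Fin k))‖ ^ 2 < η * k * a ^ 2 / 4 := by
      simpa [hS] using hi
    rw [EuclideanSpace.norm_sq_eq] at h1
    have h2 : (N i : ℝ) * a ^ 2 ≤ ∑ j, ‖V j i‖ ^ 2 := by
      calc (N i : ℝ) * a ^ 2 = ∑ j ∈ Finset.univ.filter fun j : Fin k => a ≤ ‖V j i‖, a ^ 2 := by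
            simp [N]
        _ ≤ ∑ j ∈ Finset.univ.filter fun j : Fin k => a ≤ ‖V j i‖, ‖V j i‖ ^ 2 :=
          Finset.sum_le_sum fun j hj => by
            have := (Finset.mem_filter.1 hj).2
            gcongr
        _ ≤ _ := Finset.sum_le_univ_sum_of_nonneg fun _ => by positivity
    have h3 : (N i : ℝ) * a ^ 2 ≤ η * k / 4 * a ^ 2 := by
      refine h2.trans (h1.le.trans (le_of_eq (by ring)))
    exact le_of_mul_le_mul_right h3 (by positivity)
  have h4 : (k : ℝ) * m ≤ ∑ i, (N i : ℝ) := by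
    have h5 : ∑ j : Fin k, (Finset.univ.filter fun i : Fin n => a ≤ ‖V j i‖).card = ∑ i, N i :=
      Finset.sum_card_bipartiteAbove_eq_sum_card_bipartiteBelow fun (j : Fin k) (i : Fin n) =>
        a ≤ ‖V j i‖
    have h6 : ∑ _j : Fin k, m ≤ ∑ i, N i := by
      rw [← h5]
      exact Finset.sum_le_sum fun j _ => le_card_of_le_orderStat _ ha hm (h j)
    simp only [Finset.sum_const, Finset.card_univ, Fintype.card_fin, smul_eq_mul] at h6
    exact_mod_cast h6
  have h7 : ∑ i, (N i : ℝ) ≤ S.card * k + n * (η * k / 4) := by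
    rw [← Finset.sum_filter_add_sum_filter_not Finset.univ (· ∈ S)]
    refine add_le_add ?_ ?_
    · calc _ ≤ ∑ i ∈ Finset.univ.filter (· ∈ S), (k : ℝ) := Finset.sum_le_sum fun i _ => hN1 i
        _ = _ := by simp
    · calc _ ≤ ∑ i ∈ Finset.univ.filter (· ∉ S), (η * k / 4) :=
            Finset.sum_le_sum fun i hi => hN2 i (Finset.mem_filter.1 hi).2
        _ ≤ ∑ i : Fin n, (η * k / 4) :=
            Finset.sum_le_univ_sum_of_nonneg fun _ =>
              div_nonneg (mul_nonneg hη k.cast_nonneg) zero_le_four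
        _ = _ := by simp
  have hk' : (0 : ℝ) < k := by exact_mod_cast hk
  have h8 : (k : ℝ) * (m - η * n / 4) ≤ k * S.card := by linarith
  have := le_of_mul_le_mul_left h8 hk'
  linarith

/-- The dimension parameters of a nonempty set of spread matrices. -/
theorem spread_parameter_bounds {k n : ℕ} {η ρ : ℝ} (hρ : 0 < ρ)
    (hm : 1 ≤ ⌊η * n⌋₊) (hk : 0 < k) {V : Matrix (Fin k) (Fin n) ℂ}
    (hV : V ∈ spreadMatrices k n η ρ) :
    0 < n ∧ k ≤ n ∧ η * n ≤ 2 * ⌊η * n⌋₊ ∧ η ≤ 2 ∧ η * ρ ^ 2 ≤ 2 := by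
  have hn : 0 < n := by
    rcases Nat.eq_zero_or_pos n with rfl | h
    · simp at hm
    · exact h
  have hn' : (0 : ℝ) < n := by exact_mod_cast hn
  have ha : 0 < ρ / √(n : ℝ) := by positivity
  obtain ⟨hO, hS⟩ := hV
  have hkn : k ≤ n := by
    have := hO.linearIndependent.fintype_card_le_finrank
    simpa using this
  have hmn : ⌊η * n⌋₊ ≤ n := le_of_pos_orderStat _ hm (ha.trans_le (hS ⟨0, hk⟩))
  have h2 : η * n ≤ 2 * ⌊η * n⌋₊ := by
    have := Nat.lt_floor_add_one (η * n)
    have : (1 : ℝ) ≤ ⌊η * n⌋₊ := by exact_mod_cast hm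
    linarith
  have hmn' : (⌊η * n⌋₊ : ℝ) ≤ n := by exact_mod_cast hmn
  refine ⟨hn, hkn, h2, ?_, ?_⟩
  · exact le_of_mul_le_mul_right (by linarith) hn'
  · have h3 := mul_orderStat_sq_le _ ha hm (hS ⟨0, hk⟩)
    have h4 : ∑ i, ‖V.row ⟨0, hk⟩ i‖ ^ 2 = 1 := by
      have := hO.1 ⟨0, hk⟩
      have h5 := EuclideanSpace.norm_sq_eq
        (WithLp.toLp 2 (V.row ⟨0, hk⟩) : EuclideanSpace ℂ (Fin n))
      rw [this] at h5
      simpa using h5.symm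
    rw [h4, div_pow, Real.sq_sqrt hn'.le, mul_div_assoc', div_le_one hn'] at h3
    have h6 : (η * ρ ^ 2) * n ≤ 2 * n := by
      calc (η * ρ ^ 2) * n = (η * n) * ρ ^ 2 := by ring
        _ ≤ (2 * ⌊η * n⌋₊) * ρ ^ 2 := by gcongr
        _ ≤ 2 * n := by linarith
    exact le_of_mul_le_mul_right h6 hn'

/-- A randomized restricted invertibility principle: a large proportion of column subsets of size
`l` is such that at least half of the columns are far from the span of the others. -/
theorem restricted_invertibility_card {k n l : ℕ} {η ρ : ℝ} (hη : 0 < η) (hρ : 0 < ρ)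
    (hm : 1 ≤ ⌊η * n⌋₊) {V : Matrix (Fin k) (Fin n) ℂ}
    (hV : V ∈ spreadMatrices k n η ρ) (hl : 0 < l)
    (hlk : (l : ℝ) ≤ 1 / 512 * η ^ 3 * ρ ^ 2 * k) :
    (η / 16) ^ l * n.choose l ≤
      (((Finset.univ : Finset (Fin n)).powersetCard l).filter fun I => l ≤ 2 *
        (farIndices (fun i => (WithLp.toLp 2 (V.col i) : EuclideanSpace ℂ (Fin k)))
          (η * k * ρ ^ 2 / (8 * n)) I).card).card := by
  classical
  have hl1 : (1 : ℝ) ≤ l := by exact_mod_cast hl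
  have hk : 0 < k := by
    rcases Nat.eq_zero_or_pos k with rfl | h
    · simp at hlk; linarith
    · exact h
  obtain ⟨hn, hkn, h2m, hη2, hηρ⟩ := spread_parameter_bounds hρ hm hk hV
  have hn' : (0 : ℝ) < n := by exact_mod_cast hn
  have hk' : (0 : ℝ) < k := by exact_mod_cast hk
  have hkn' : (k : ℝ) ≤ n := by exact_mod_cast hkn
  set v : Fin n → EuclideanSpace ℂ (Fin k) := fun i => WithLp.toLp 2 (V.col i)
  set τ : ℝ := η * k * ρ ^ 2 / (8 * n) with hτ
  have hτ0 : 0 < τ := by positivity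
  set S := Finset.univ.filter fun i : Fin n => η * k * (ρ / √(n : ℝ)) ^ 2 / 4 ≤ ‖v i‖ ^ 2 with hS
  have hScard : η * n / 4 ≤ S.card :=
    mul_div_le_card_large_columns V (by positivity) hk hm hV.2 hη.le h2m
  have hSτ : ∀ i ∈ S, 2 * τ ≤ ‖v i‖ ^ 2 := by
    intro i hi
    refine le_trans (le_of_eq ?_) (Finset.mem_filter.1 hi).2
    rw [hτ, div_pow, Real.sq_sqrt hn'.le]
    field_simp
    norm_num
  -- The bounds `η ≤ 2` and `η * ρ ^ 2 ≤ 2` give `l ≤ η * n / 128`, well below `η * n / 8`.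
  have hlS : (l : ℝ) ≤ S.card / 2 := by
    have h1 : η ^ 3 * ρ ^ 2 * k ≤ 4 * (η * n) := by
      calc η ^ 3 * ρ ^ 2 * k = η * (η * (η * ρ ^ 2)) * k := by ring
        _ ≤ η * (2 * 2) * n := by gcongr
        _ = _ := by ring
    nlinarith [mul_pos hη hn']
  obtain ⟨l, rfl⟩ : ∃ l', l = l' + 1 := ⟨l - 1, by omega⟩
  push_cast at hlS hlk hl1
  -- The constant `1 / 512` is chosen here: with `η ≤ 2`, both sides are compared with `η ^ 2 * ρ ^
  -- 2 * k / 64`.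
  have hτl : 4 * (l : ℝ) ≤ τ * (S.card - l) := by
    have h1 : η * n / 8 ≤ S.card - l := by linarith
    have h2 : 4 * (1 / 512 * η ^ 3 * ρ ^ 2 * k) ≤ η ^ 2 * ρ ^ 2 * k / 64 := by
      calc 4 * (1 / 512 * η ^ 3 * ρ ^ 2 * k) = η * (η ^ 2 * ρ ^ 2 * k / 128) := by ring
        _ ≤ 2 * (η ^ 2 * ρ ^ 2 * k / 128) := by gcongr
        _ = _ := by ring
    calc 4 * (l : ℝ) ≤ 4 * (1 / 512 * η ^ 3 * ρ ^ 2 * k) := by linarith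
      _ ≤ η ^ 2 * ρ ^ 2 * k / 64 := h2
      _ = τ * (η * n / 8) := by rw [hτ]; field_simp; norm_num
      _ ≤ _ := by gcongr
  have hlS' : l + 1 ≤ S.card := by
    have : ((l : ℝ) + 1) ≤ S.card := by linarith
    exact_mod_cast this
  have h1 := half_choose_le_card_farIndices v
    (fun u => (sum_norm_sq_inner_col_of_orthonormal_row V hV.1 u).le) S hτ0 hSτ l hlS' hτl
  have h2 : (η / 8) ^ (l + 1) * n.choose (l + 1) ≤ S.card.choose (l + 1) := by
    refine pow_mul_choose_le_choose (by positivity) hn ?_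
    push_cast
    linarith
  -- The loss of one half is absorbed into the power, turning `η / 8` into `η / 16`.
  have h3 : (1 / 2 : ℝ) ^ (l + 1) ≤ 1 / 2 := pow_le_of_le_one (by norm_num) (by norm_num) (by omega)
  calc (η / 16) ^ (l + 1) * n.choose (l + 1)
      = (1 / 2) ^ (l + 1) * ((η / 8) ^ (l + 1) * n.choose (l + 1)) := by
        rw [← mul_assoc, ← mul_pow]; ring_nf
    _ ≤ 1 / 2 * S.card.choose (l + 1) := by gcongr
    _ = S.card.choose (l + 1) / 2 := by ring
    _ ≤ _ := h1
    _ ≤ _ := by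
      norm_cast
      exact Finset.card_le_card
        (Finset.filter_subset_filter _ (Finset.powersetCard_mono (Finset.subset_univ _)))

/-! ### From a small product to short columns -/

/-- The image of a matrix-vector product under the projection along the columns outside `I`. -/
theorem colProj_mulVec {n : ℕ} (I : Finset (Fin n)) (M : Matrix (Fin n) (Fin n) ℂ)
    (y : Fin n → ℂ) :
    colProj I M (WithLp.toLp 2 (M *ᵥ y)) = ∑ i ∈ I, y i • colProj I M (colVec M i) := by
  have h1 : (WithLp.toLp 2 (M *ᵥ y) : EuclideanSpace ℂ (Fin n)) = ∑ i, y i • colVec M i := by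
    ext a
    simp [Matrix.mulVec, dotProduct, colVec, mul_comm]
  rw [h1, map_sum]
  simp_rw [map_smul]
  symm
  refine Finset.sum_subset (Finset.subset_univ _) fun i _ hi => ?_
  have : colProj I M (colVec M i) = 0 := by
    rw [colProj, Submodule.starProjection_apply_eq_zero_iff]
    exact Submodule.le_orthogonal_orthogonal _ (Submodule.subset_span ⟨i, hi, rfl⟩)
  rw [this, smul_zero]

/-- The distance of the `j`-th column of `M` to the span of the columns outside `I`, times the
distance of the `j`-th column of `V` to the span of its other columns in `I`, is at most
`‖M * Vᵀ‖`. -/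
theorem norm_colProj_mul_norm_orthComponent_le {k n : ℕ} (M : Matrix (Fin n) (Fin n) ℂ)
    (V : Matrix (Fin k) (Fin n) ℂ) {I : Finset (Fin n)} {j : Fin n} (hj : j ∈ I)
    (h0 : orthComponent (fun i => (WithLp.toLp 2 (V.col i) : EuclideanSpace ℂ (Fin k))) I j ≠ 0) :
    ‖colProj I M (colVec M j)‖ *
      ‖orthComponent (fun i => (WithLp.toLp 2 (V.col i) : EuclideanSpace ℂ (Fin k))) I j‖
      ≤ ‖M * Vᵀ‖ := by
  set v : Fin n → EuclideanSpace ℂ (Fin k) := fun i => WithLp.toLp 2 (V.col i) with hv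
  set u := orthComponent v I j with hu
  -- The conjugate is needed because `Vᵀ` is the plain transpose.
  set w : EuclideanSpace ℂ (Fin k) := WithLp.toLp 2 fun a => star (u a) with hw
  have hwu : ‖w‖ = ‖u‖ := by simp [EuclideanSpace.norm_eq, hw]
  have hy : ∀ i, (Vᵀ *ᵥ w.ofLp) i = inner ℂ u (v i) := by
    intro i
    simp [Matrix.mulVec, dotProduct, hw, hv, PiLp.inner_apply]
  have h1 := (M * Vᵀ).l2_opNorm_mulVec w
  rw [hwu] at h1
  have h2 : colProj I M (WithLp.toLp 2 ((M * Vᵀ) *ᵥ w.ofLp))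
      = (inner ℂ u (v j)) • colProj I M (colVec M j) := by
    rw [← Matrix.mulVec_mulVec, colProj_mulVec, Finset.sum_eq_single_of_mem j hj, hy]
    intro i hi hij
    rw [hy]
    have : inner ℂ u (v i) = 0 := by
      rw [hu, orthComponent]
      have hi' : v i ∈ v '' (I.erase j : Finset (Fin n)) := ⟨i, by simp [hi, hij], rfl⟩
      exact Submodule.inner_left_of_mem_orthogonal (Submodule.subset_span hi')
        (Submodule.starProjection_apply_mem _ _)
    rw [this, zero_smul]
  have h3 : ‖inner ℂ u (v j)‖ = ‖u‖ ^ 2 := by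
    have h5 : inner ℂ u (v j) = inner ℂ u u := by
      conv_rhs => rw [hu, orthComponent, Submodule.inner_starProjection_left_eq_right,
        Submodule.starProjection_eq_self_iff.2 (Submodule.starProjection_apply_mem _ _),
        ← Submodule.inner_starProjection_left_eq_right]
      rfl
    rw [h5, inner_self_eq_norm_sq_to_K]
    simp
  have h4 : ‖colProj I M (WithLp.toLp 2 ((M * Vᵀ) *ᵥ w.ofLp))‖ ≤ ‖M * Vᵀ‖ * ‖u‖ := by
    refine le_trans ?_ h1
    exact Submodule.norm_starProjection_apply_le _ _
  rw [h2, norm_smul, h3] at h4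
  have hpos : 0 < ‖u‖ := norm_pos_iff.2 h0
  refine le_of_mul_le_mul_right ?_ hpos
  calc _ = ‖u‖ ^ 2 * ‖colProj I M (colVec M j)‖ := by ring
    _ ≤ _ := h4

/-! ### Conditioning and independence -/

/-- The conditional probability of an event depending on two independent variables, given one of
them, is computed by freezing that variable. -/
theorem condProb_of_indepFun {Ω α β : Type*} [MeasurableSpace Ω] [mα : MeasurableSpace α]
    [MeasurableSpace β] {μ : Measure Ω} [IsProbabilityMeasure μ] {X : Ω → α} {Y : Ω → β}
    (hX : Measurable X) (hY : Measurable Y) (hXY : IndepFun X Y μ) {D : Set (α × β)}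
    (hD : MeasurableSet D) :
    (fun ω => (μ.map Y).real (Prod.mk (X ω) ⁻¹' D))
      =ᵐ[μ] μ⟦{ω | (X ω, Y ω) ∈ D} | mα.comap X⟧ := by
  have : IsProbabilityMeasure (μ.map Y) := Measure.isProbabilityMeasure_map hY.aemeasurable
  have hmap := hXY.map_prod_eq_prod_map_map hX.aemeasurable hY.aemeasurable
  have hE : MeasurableSet {ω | (X ω, Y ω) ∈ D} := (hX.prodMk hY) hD
  have hg : Measurable fun x => (μ.map Y) (Prod.mk x ⁻¹' D) := measurable_measure_prodMk_left hD
  have hgX : Measurable[mα.comap X] fun ω => (μ.map Y) (Prod.mk (X ω) ⁻¹' D) :=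
    hg.comp (comap_measurable X)
  have hgX' : Measurable fun ω => (μ.map Y) (Prod.mk (X ω) ⁻¹' D) := hg.comp hX
  refine ae_eq_condExp_of_forall_setIntegral_eq hX.comap_le ?_ ?_ ?_ ?_
  · exact (integrable_const _).indicator hE
  · intro s _ _
    refine Integrable.integrableOn ?_
    refine Integrable.of_bound hgX'.ennreal_toReal.aestronglyMeasurable 1
      (Filter.Eventually.of_forall fun ω => ?_)
    rw [Real.norm_of_nonneg measureReal_nonneg]
    exact measureReal_le_one
  -- Both integrals over `X ⁻¹' A` equal the mass of `D ∩ A ×ˢ univ` under the product of the laws.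
  · rintro s ⟨A, hA, rfl⟩ _
    simp_rw [measureReal_def]
    rw [integral_toReal hgX'.aemeasurable
      (Filter.Eventually.of_forall fun ω => measure_lt_top _ _),
      integral_indicator_const _ hE, measureReal_restrict_apply hE, smul_eq_mul, mul_one,
      measureReal_def, ← setLIntegral_map hA hg hX]
    congr 1
    have h1 : (μ.map fun ω => (X ω, Y ω)) (D ∩ A ×ˢ Set.univ) =
        μ ({ω | (X ω, Y ω) ∈ D} ∩ X ⁻¹' A) := by
      rw [Measure.map_apply (hX.prodMk hY) (hD.inter (hA.prod MeasurableSet.univ))]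
      congr 1
      ext ω
      simp
    rw [← h1, hmap, Measure.prod_apply (hD.inter (hA.prod MeasurableSet.univ)),
      ← lintegral_indicator hA]
    refine lintegral_congr fun x => ?_
    by_cases hx : x ∈ A <;> simp [hx, Set.indicator]
  · exact hgX.ennreal_toReal.aestronglyMeasurable

/-- If `X` and a family `Y j` are jointly independent and each event `(X, Y j) ∈ D j` has
conditional probability at most `t` given `X ∈ F`, then all of these events occur simultaneously
with probability at most `t ^ card ι`. -/
theorem measure_forall_mem_le_pow {Ω α β ι : Type*} [Fintype ι] [MeasurableSpace Ω]
    [mα : MeasurableSpace α] [MeasurableSpace β] {μ : Measure Ω} [IsProbabilityMeasure μ]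
    {X : Ω → α} {Y : ι → Ω → β} (hX : Measurable X) (hY : ∀ j, Measurable (Y j))
    (hXY : IndepFun X (fun ω j => Y j ω) μ) (hYY : iIndepFun Y μ) {D : ι → Set (α × β)}
    (hD : ∀ j, MeasurableSet (D j)) {F : Set α} (hF : MeasurableSet F) {t : ℝ}
    (h : ∀ j, ∀ᵐ ω ∂μ, X ω ∈ F → (μ⟦{ω | (X ω, Y j ω) ∈ D j} | mα.comap X⟧) ω ≤ t) :
    μ {ω | X ω ∈ F ∧ ∀ j, (X ω, Y j ω) ∈ D j} ≤ ENNReal.ofReal t ^ Fintype.card ι := by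
  have hp : ∀ j, IsProbabilityMeasure (μ.map (Y j)) := fun j =>
    Measure.isProbabilityMeasure_map (hY j).aemeasurable
  have hpX : IsProbabilityMeasure (μ.map X) := Measure.isProbabilityMeasure_map hX.aemeasurable
  have hYm : Measurable fun ω j => Y j ω := measurable_pi_lambda _ hY
  have hmap := hXY.map_prod_eq_prod_map_map hX.aemeasurable hYm.aemeasurable
  rw [(iIndepFun_iff_map_fun_eq_pi_map fun j => (hY j).aemeasurable).1 hYY] at hmap
  have hT : MeasurableSet {p : α × (ι → β) | p.1 ∈ F ∧ ∀ j, (p.1, p.2 j) ∈ D j} := by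
    have : {p : α × (ι → β) | p.1 ∈ F ∧ ∀ j, (p.1, p.2 j) ∈ D j} =
        Prod.fst ⁻¹' F ∩ ⋂ j, (fun p : α × (ι → β) => (p.1, p.2 j)) ⁻¹' D j := by ext; simp
    rw [this]
    exact (measurable_fst hF).inter
      (MeasurableSet.iInter fun j => (by fun_prop : Measurable _) (hD j))
  have h1 : μ {ω | X ω ∈ F ∧ ∀ j, (X ω, Y j ω) ∈ D j} =
      (μ.map fun ω => (X ω, fun j => Y j ω))
        {p : α × (ι → β) | p.1 ∈ F ∧ ∀ j, (p.1, p.2 j) ∈ D j} := by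
    rw [Measure.map_apply (hX.prodMk hYm) hT]; rfl
  rw [h1, hmap, Measure.prod_apply hT]
  -- The conditional bounds become bounds on slices for almost every value of `X`; each joint slice
  -- is then a box, whose product measure factors.
  have h2 : ∀ j, ∀ᵐ x ∂(μ.map X), x ∈ F → (μ.map (Y j)) (Prod.mk x ⁻¹' D j) ≤
      ENNReal.ofReal t := by
    intro j
    have hms : MeasurableSet {x | x ∈ F → (μ.map (Y j)) (Prod.mk x ⁻¹' D j) ≤
        ENNReal.ofReal t} := by
      have : MeasurableSet {x | (μ.map (Y j)) (Prod.mk x ⁻¹' D j) ≤ ENNReal.ofReal t} :=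
        measurableSet_le (measurable_measure_prodMk_left (hD j)) measurable_const
      exact hF.imp this
    rw [ae_map_iff hX.aemeasurable hms]
    have hind : IndepFun X (Y j) μ := hXY.comp measurable_id (measurable_pi_apply j)
    filter_upwards [h j, condProb_of_indepFun hX (hY j) hind (hD j)] with ω h3 h4 h5
    have h6 := h3 h5
    rw [← h4] at h6
    rw [← ENNReal.ofReal_toReal (measure_ne_top (μ.map (Y j)) _)]
    exact ENNReal.ofReal_le_ofReal h6
  calc _ ≤ ∫⁻ _, ENNReal.ofReal t ^ Fintype.card ι ∂(μ.map X) := by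
        refine lintegral_mono_ae ?_
        filter_upwards [ae_all_iff.2 h2] with x hx
        by_cases hxF : x ∈ F
        · have : Prod.mk x ⁻¹' {p : α × (ι → β) | p.1 ∈ F ∧ ∀ j, (p.1, p.2 j) ∈ D j} =
              Set.univ.pi fun j => Prod.mk x ⁻¹' D j := by
            ext y; simp [hxF]
          rw [this, Measure.pi_pi]
          exact (Finset.prod_le_prod' fun j _ => hx j hxF).trans (by simp)
        · simp [hxF]
    _ = _ := by simp

/-! ### Measurability of distances to column spans -/

/-- The distance of a vector to the span of the columns of a matrix is jointly measurable. -/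
theorem measurableSet_norm_starProjection_orthogonal_le {n : ℕ} {κ : Type*} [Fintype κ] (r : ℝ) :
    MeasurableSet {p : Matrix (Fin n) κ ℂ × (Fin n → ℂ) |
      ‖((Submodule.span ℂ (Set.range fun j =>
        (WithLp.toLp 2 (p.1.col j) : EuclideanSpace ℂ (Fin n))))ᗮ).starProjection
          (WithLp.toLp 2 p.2)‖ ≤ r} := by
  have hsum : ∀ (M : Matrix (Fin n) κ ℂ) (a : κ → ℂ),
      (WithLp.toLp 2 (M *ᵥ a) : EuclideanSpace ℂ (Fin n)) =
        ∑ j, a j • (WithLp.toLp 2 (M.col j) : EuclideanSpace ℂ (Fin n)) := by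
    intro M a
    ext i
    simp [Matrix.mulVec, dotProduct, mul_comm]
  -- The distance is an infimum over coefficient vectors; a dense sequence and the slack `1 / (q +
  -- 1)` make the condition countable.
  have key : {p : Matrix (Fin n) κ ℂ × (Fin n → ℂ) |
      ‖((Submodule.span ℂ (Set.range fun j =>
        (WithLp.toLp 2 (p.1.col j) : EuclideanSpace ℂ (Fin n))))ᗮ).starProjection
          (WithLp.toLp 2 p.2)‖ ≤ r} =
      ⋂ q : ℕ, ⋃ i : ℕ, {p | ‖(WithLp.toLp 2 (p.2 - p.1 *ᵥ TopologicalSpace.denseSeq (κ → ℂ) i) :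
        EuclideanSpace ℂ (Fin n))‖ < r + 1 / ((q : ℝ) + 1)} := by
    ext ⟨M, x⟩
    simp only [Set.mem_ofPred_eq, Set.mem_iInter, Set.mem_iUnion]
    set U := Submodule.span ℂ (Set.range fun j =>
        (WithLp.toLp 2 (M.col j) : EuclideanSpace ℂ (Fin n)))
    constructor
    · intro h q
      obtain ⟨a, ha⟩ := (Submodule.mem_span_range_iff_exists_fun ℂ).1
        (U.starProjection_apply_mem (WithLp.toLp 2 x))
      rw [← hsum] at ha
      have hcont : Continuous fun b : κ → ℂ =>
          ‖(WithLp.toLp 2 (x - M *ᵥ b) : EuclideanSpace ℂ (Fin n))‖ := by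
        have : Continuous fun b : κ → ℂ => M *ᵥ b := by fun_prop
        fun_prop
      have hopen := isOpen_lt hcont (continuous_const (y := r + 1 / ((q : ℝ) + 1)))
      refine (TopologicalSpace.denseRange_denseSeq (κ → ℂ)).exists_mem_open hopen ⟨a, ?_⟩
      rw [Submodule.starProjection_orthogonal_val] at h
      simp only [Set.mem_ofPred_eq, WithLp.toLp_sub, ha]
      have : (0 : ℝ) < 1 / ((q : ℝ) + 1) := by positivity
      linarith
    · intro h
      refine le_of_forall_pos_lt_add fun ε hε => ?_
      obtain ⟨q, hq⟩ := exists_nat_one_div_lt hε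
      obtain ⟨i, hi⟩ := h q
      have hU : (WithLp.toLp 2 (M *ᵥ TopologicalSpace.denseSeq (κ → ℂ) i) :
          EuclideanSpace ℂ (Fin n)) ∈ U := by
        rw [hsum]
        exact U.sum_mem fun j _ => U.smul_mem _ (Submodule.subset_span ⟨j, rfl⟩)
      have h0 : Uᗮ.starProjection (WithLp.toLp 2 x) = Uᗮ.starProjection
          (WithLp.toLp 2 (x - M *ᵥ TopologicalSpace.denseSeq (κ → ℂ) i)) := by
        rw [WithLp.toLp_sub, map_sub, (Submodule.starProjection_apply_eq_zero_iff _).2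
          (Submodule.le_orthogonal_orthogonal _ hU), sub_zero]
      rw [h0]
      calc _ ≤ _ := Submodule.norm_starProjection_apply_le _ _
        _ < r + 1 / ((q : ℝ) + 1) := hi
        _ < _ := by linarith
  rw [key]
  refine MeasurableSet.iInter fun q => MeasurableSet.iUnion fun i => ?_
  refine measurableSet_lt ?_ measurable_const
  simp_rw [EuclideanSpace.norm_eq]
  refine Measurable.sqrt (Finset.measurable_sum _ fun a _ => ?_)
  refine (Measurable.norm ?_).pow_const 2
  have hM : ∀ c, Measurable fun p : Matrix (Fin n) κ ℂ × (Fin n → ℂ) => p.1 a c := fun c =>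
    (measurable_pi_apply c).comp ((measurable_pi_apply a).comp measurable_fst)
  simp only [Matrix.mulVec, dotProduct, Pi.sub_apply]
  refine ((measurable_pi_apply a).comp measurable_snd).sub (Finset.measurable_sum _ fun c _ => ?_)
  exact (hM c).mul_const _

theorem complSpan_eq_span_range {n : ℕ} (I : Finset (Fin n)) (M : Matrix (Fin n) (Fin n) ℂ) :
    complSpan I M = Submodule.span ℂ (Set.range fun j =>
      (WithLp.toLp 2 ((complCols I M).col j) : EuclideanSpace ℂ (Fin n))) := by
  unfold complSpan
  congr 1
  ext v
  constructor
  · rintro ⟨j, hj, rfl⟩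
    exact ⟨⟨j, hj⟩, rfl⟩
  · rintro ⟨⟨j, hj⟩, rfl⟩
    exact ⟨j, hj, rfl⟩

theorem measurable_complCols {n : ℕ} (I : Finset (Fin n)) : Measurable (complCols I) :=
  measurable_pi_lambda _ fun i => measurable_pi_lambda _ fun j =>
    (measurable_pi_apply (X := fun _ : Fin n => ℂ) j.1).comp
      (measurable_pi_apply (X := fun _ : Fin n => Fin n → ℂ) i)

theorem measurable_col {n : ℕ} (j : Fin n) :
    Measurable fun M : Matrix (Fin n) (Fin n) ℂ => M.col j :=
  measurable_pi_lambda _ fun i =>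
    (measurable_pi_apply (X := fun _ : Fin n => ℂ) j).comp
      (measurable_pi_apply (X := fun _ : Fin n => Fin n → ℂ) i)

theorem measurableSet_norm_colProj_le {n : ℕ} (I : Finset (Fin n)) (j : Fin n) (r : ℝ) :
    MeasurableSet {M : Matrix (Fin n) (Fin n) ℂ | ‖colProj I M (colVec M j)‖ ≤ r} := by
  have := ((measurable_complCols I).prodMk (measurable_col j))
    (measurableSet_norm_starProjection_orthogonal_le (n := n) (κ := {j : Fin n // j ∉ I}) r)
  simp only [colProj, complSpan_eq_span_range]
  exact this

/-! ### Joint small ball estimates -/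

/-- Independence of the columns turns small ball estimates for single columns into a joint one. -/
theorem measure_forall_norm_colProj_le {n : ℕ} {Ω : Type*} [MeasurableSpace Ω] {μ : Measure Ω}
    [IsProbabilityMeasure μ] {B : Ω → Matrix (Fin n) (Fin n) ℂ} (hB : Measurable B)
    (hind : iIndepFun (fun (j : Fin n) (ω : Ω) => (B ω).col j) μ) {I L : Finset (Fin n)}
    (hLI : L ⊆ I) {F : Set (Matrix (Fin n) {j : Fin n // j ∉ I} ℂ)} (hF : MeasurableSet F)
    {r t : ℝ} (h : ∀ j ∈ I, ∀ᵐ ω ∂μ, complCols I (B ω) ∈ F →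
      (μ⟦{ω' | ‖colProj I (B ω') (colVec (B ω') j)‖ ≤ r} |
        MeasurableSpace.comap (fun ω' => complCols I (B ω')) inferInstance⟧) ω ≤ t) :
    μ {ω | complCols I (B ω) ∈ F ∧ ∀ j ∈ L, ‖colProj I (B ω) (colVec (B ω) j)‖ ≤ r} ≤
      ENNReal.ofReal t ^ L.card := by
  have hcol : ∀ j, Measurable fun ω => (B ω).col j := fun j => (measurable_col j).comp hB
  have h1 : IndepFun (fun ω => complCols I (B ω)) (fun ω (j : L) => (B ω).col j) μ := by
    have hdis : Disjoint (Finset.univ \ I) L :=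
      Finset.disjoint_left.2 fun a ha ha' => (Finset.mem_sdiff.1 ha).2 (hLI ha')
    have h2 := hind.indepFun_finset (Finset.univ \ I) L hdis hcol
    have hφ : Measurable fun (g : (Finset.univ \ I : Finset (Fin n)) → Fin n → ℂ) =>
        (Matrix.of fun i (j : {j : Fin n // j ∉ I}) => g ⟨j, by simp [j.2]⟩ i :
          Matrix (Fin n) {j : Fin n // j ∉ I} ℂ) :=
      measurable_pi_lambda _ fun i => measurable_pi_lambda _ fun j =>
        (measurable_pi_apply i).comp (measurable_pi_apply _)
    exact h2.comp hφ measurable_id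
  have h3 := measure_forall_mem_le_pow (Y := fun (j : L) ω => (B ω).col j)
    (D := fun _ => {p : Matrix (Fin n) {j : Fin n // j ∉ I} ℂ × (Fin n → ℂ) |
      ‖((Submodule.span ℂ (Set.range fun j =>
        (WithLp.toLp 2 (p.1.col j) : EuclideanSpace ℂ (Fin n))))ᗮ).starProjection
          (WithLp.toLp 2 p.2)‖ ≤ r}) (t := t)
    ((measurable_complCols I).comp hB) (fun j => hcol j) h1
    (hind.precomp Subtype.val_injective)
    (fun _ => measurableSet_norm_starProjection_orthogonal_le r) hF ?_
  · rw [Fintype.card_coe] at h3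
    refine le_trans (measure_mono ?_) h3
    rintro ω ⟨hω, hω'⟩
    refine ⟨hω, fun j => ?_⟩
    have := hω' j j.2
    simp only [colProj, complSpan_eq_span_range] at this
    exact this
  · intro j
    have := h j (hLI j.2)
    simp only [colProj, complSpan_eq_span_range] at this
    exact this

/-- The event that the submatrix of `M` outside `I` belongs to `F` while at least half of the
columns in `I` are at distance at most `r` from its column span. -/
def manyShortColumns {n : ℕ} (I : Finset (Fin n)) (F : Set (Matrix (Fin n) {j : Fin n // j ∉ I} ℂ))
    (r : ℝ) : Set (Matrix (Fin n) (Fin n) ℂ) :=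
  ⋃ L ∈ I.powerset.filter fun L => I.card ≤ 2 * L.card,
    {M | complCols I M ∈ F ∧ ∀ j ∈ L, ‖colProj I M (colVec M j)‖ ≤ r}

theorem measurableSet_manyShortColumns {n : ℕ} (I : Finset (Fin n))
    {F : Set (Matrix (Fin n) {j : Fin n // j ∉ I} ℂ)} (hF : MeasurableSet F) (r : ℝ) :
    MeasurableSet (manyShortColumns I F r) := by
  refine Finset.measurableSet_biUnion _ fun L _ => ?_
  have : {M : Matrix (Fin n) (Fin n) ℂ |
      complCols I M ∈ F ∧ ∀ j ∈ L, ‖colProj I M (colVec M j)‖ ≤ r} =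
      complCols I ⁻¹' F ∩ ⋂ j ∈ L, {M | ‖colProj I M (colVec M j)‖ ≤ r} := by
    ext; simp
  rw [this]
  exact (measurable_complCols I hF).inter
    (Finset.measurableSet_biInter _ fun j _ => measurableSet_norm_colProj_le I j r)

/-- Union bound over at most `2 ^ I.card` sets `L`; as `t ≤ 1` and `I.card ≤ 2 * L.card`, each `t ^
L.card` is at most `√t ^ I.card`. -/
theorem measure_manyShortColumns_le {n : ℕ} {Ω : Type*} [MeasurableSpace Ω] {μ : Measure Ω}
    [IsProbabilityMeasure μ] {B : Ω → Matrix (Fin n) (Fin n) ℂ} (hB : Measurable B)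
    (hind : iIndepFun (fun (j : Fin n) (ω : Ω) => (B ω).col j) μ) {I : Finset (Fin n)}
    {F : Set (Matrix (Fin n) {j : Fin n // j ∉ I} ℂ)} (hF : MeasurableSet F)
    {r t : ℝ} (ht : 0 ≤ t) (ht1 : t ≤ 1) (h : ∀ j ∈ I, ∀ᵐ ω ∂μ, complCols I (B ω) ∈ F →
      (μ⟦{ω' | ‖colProj I (B ω') (colVec (B ω') j)‖ ≤ r} |
        MeasurableSpace.comap (fun ω' => complCols I (B ω')) inferInstance⟧) ω ≤ t) :
    μ (B ⁻¹' manyShortColumns I F r) ≤ ENNReal.ofReal ((2 * √t) ^ I.card) := by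
  have hpow : ∀ L ∈ I.powerset.filter fun L => I.card ≤ 2 * L.card,
      μ (B ⁻¹' {M | complCols I M ∈ F ∧ ∀ j ∈ L, ‖colProj I M (colVec M j)‖ ≤ r}) ≤
        ENNReal.ofReal (√t ^ I.card) := by
    intro L hL
    rw [Finset.mem_filter, Finset.mem_powerset] at hL
    refine (measure_forall_norm_colProj_le hB hind hL.1 hF h).trans ?_
    rw [← ENNReal.ofReal_pow ht]
    refine ENNReal.ofReal_le_ofReal ?_
    calc t ^ L.card = √t ^ (2 * L.card) := by rw [pow_mul, Real.sq_sqrt ht]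
      _ ≤ √t ^ I.card :=
        pow_le_pow_of_le_one (Real.sqrt_nonneg _) (Real.sqrt_le_one.2 ht1) hL.2
  simp only [manyShortColumns, Set.preimage_iUnion]
  calc _ ≤ ∑ L ∈ I.powerset.filter fun L => I.card ≤ 2 * L.card,
        μ (B ⁻¹' {M | complCols I M ∈ F ∧ ∀ j ∈ L, ‖colProj I M (colVec M j)‖ ≤ r}) :=
        measure_biUnion_finset_le _ _
    _ ≤ ∑ L ∈ I.powerset.filter fun L => I.card ≤ 2 * L.card, ENNReal.ofReal (√t ^ I.card) :=
        Finset.sum_le_sum hpow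
    _ ≤ ∑ L ∈ I.powerset, ENNReal.ofReal (√t ^ I.card) :=
        Finset.sum_le_sum_of_subset (Finset.filter_subset _ _)
    _ = _ := by
      rw [Finset.sum_const, Finset.card_powerset, mul_pow, ENNReal.ofReal_mul (by positivity),
        nsmul_eq_mul]
      congr 1
      rw [ENNReal.ofReal_pow (by norm_num)]
      simp

/-! ### Averaging over column subsets and conclusion -/

/-- If many events `A I` of probability at most `p` have to occur simultaneously for `T` to occur,
then `T` is improbable. -/
theorem measure_mul_le_of_forall_le_card {Ω ι : Type*} [MeasurableSpace Ω] (μ : Measure Ω)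
    (s : Finset ι) (A : ι → Set Ω) (hA : ∀ i ∈ s, MeasurableSet (A i)) {p : ENNReal}
    (hp : ∀ i ∈ s, μ (A i) ≤ p) (T : Set Ω) (a : ENNReal)
    (hT : ∀ ω ∈ T, a ≤ ∑ i ∈ s, (A i).indicator 1 ω) : a * μ T ≤ s.card * p := by
  have hm : ∀ i ∈ s, Measurable ((A i).indicator (1 : Ω → ENNReal)) := fun i hi =>
    measurable_one.indicator (hA i hi)
  -- Passing to the superlevel set avoids any measurability of `T`.
  calc a * μ T ≤ a * μ {ω | a ≤ ∑ i ∈ s, (A i).indicator 1 ω} := by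
        gcongr
        exact hT
    _ ≤ ∫⁻ ω, ∑ i ∈ s, (A i).indicator 1 ω ∂μ :=
        mul_meas_ge_le_lintegral (Finset.measurable_sum _ hm) a
    _ = ∑ i ∈ s, μ (A i) := by
        rw [lintegral_finsetSum' _ fun i hi => (hm i hi).aemeasurable]
        exact Finset.sum_congr rfl fun i hi => lintegral_indicator_one (hA i hi)
    _ ≤ ∑ i ∈ s, p := Finset.sum_le_sum hp
    _ = _ := by simp

open Classical in
/-- If `M * Vᵀ` is small for a spread matrix `V` and `M` has few exceptional submatrices, then
many column subsets of `M` have many short columns. -/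
theorem le_card_manyShortColumns {k n l : ℕ} {η ρ s : ℝ} (hη : 0 < η) (hρ : 0 < ρ)
    (hm : 1 ≤ ⌊η * n⌋₊) {V : Matrix (Fin k) (Fin n) ℂ}
    (hV : V ∈ spreadMatrices k n η ρ) (hl : 0 < l)
    (hlk : (l : ℝ) ≤ 1 / 512 * η ^ 3 * ρ ^ 2 * k) (M : Matrix (Fin n) (Fin n) ℂ)
    (hM : ‖M * Vᵀ‖ ≤ s) (F : (I : Finset (Fin n)) → Set (Matrix (Fin n) {j : Fin n // j ∉ I} ℂ))
    (hF : exceptionalProb l F M ≤ (1 / 16 * η / 2) ^ l) :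
    (η / 32) ^ l * n.choose l ≤
      ({I ∈ (Finset.univ : Finset (Fin n)).powersetCard l | M ∈ manyShortColumns I (F I)
        (√2 / (1 / 2 * ρ) * √((n : ℝ) / (η * k)) * s)}.card : ℝ) := by
  have hk : 0 < k := by
    rcases Nat.eq_zero_or_pos k with rfl | h
    · have : (1 : ℝ) ≤ l := by exact_mod_cast hl
      simp at hlk; linarith
    · exact h
  have hn : 0 < n := (spread_parameter_bounds hρ hm hk hV).1
  have hRI := restricted_invertibility_card hη hρ hm hV hl hlk
  set v : Fin n → EuclideanSpace ℂ (Fin k) := fun i => WithLp.toLp 2 (V.col i)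
  set τ : ℝ := η * k * ρ ^ 2 / (8 * n) with hτ
  have hτ0 : 0 < τ := by positivity
  set G := ((Finset.univ : Finset (Fin n)).powersetCard l).filter fun I =>
    l ≤ 2 * (farIndices v τ I).card
  set X := ((Finset.univ : Finset (Fin n)).powersetCard l).filter fun J => complCols J M ∉ F J
  -- The choice `c = 1 / 2` makes the radius exactly `s / √τ`.
  have hr : √2 / (1 / 2 * ρ) * √((n : ℝ) / (η * k)) * s = s / √τ := by
    have h8 : √2 / (1 / 2 * ρ) * √((n : ℝ) / (η * k)) = 1 / √τ := by
      rw [← Real.sqrt_one, ← Real.sqrt_div zero_le_one, Real.sqrt_one]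
      symm
      rw [Real.sqrt_eq_iff_mul_self_eq (by positivity) (by positivity), ← sq, mul_pow, div_pow,
        Real.sq_sqrt (by positivity), Real.sq_sqrt (by positivity), hτ]
      field_simp
      norm_num
    rw [h8]; ring
  rw [hr]
  have hX : (X.card : ℝ) ≤ (η / 32) ^ l * n.choose l := by
    have h1 : {J : Finset (Fin n) | J.card = l ∧ complCols J M ∉ F J} = (X : Set _) := by
      ext J; simp [X, Finset.mem_powersetCard]
    rw [exceptionalProb, h1, Set.ncard_coe_finset] at hF
    -- If `n.choose l = 0`, division by zero makes `hF` empty of content, but there are no `l`-sets.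
    rcases Nat.eq_zero_or_pos (n.choose l) with h0 | h0
    · have : X.card ≤ n.choose l := by
        refine (Finset.card_filter_le _ _).trans ?_
        simp
      have h2 : X.card = 0 := by omega
      simp [h2, h0]
    · rw [div_le_iff₀ (by exact_mod_cast h0)] at hF
      refine hF.trans (le_of_eq ?_)
      ring_nf
  have hsub : G \ X ⊆ {I ∈ (Finset.univ : Finset (Fin n)).powersetCard l |
      M ∈ manyShortColumns I (F I) (s / √τ)} := by
    intro I hI
    rw [Finset.mem_sdiff, Finset.mem_filter, Finset.mem_filter] at hI
    obtain ⟨⟨hIl, hfar⟩, hIX⟩ := hI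
    have hIF : complCols I M ∈ F I := by
      by_contra h
      exact hIX ⟨hIl, h⟩
    rw [Finset.mem_filter]
    refine ⟨hIl, Set.mem_biUnion (x := farIndices v τ I) ?_ ⟨hIF, fun j hj => ?_⟩⟩
    · simp only [Finset.coe_filter, Finset.mem_powerset, Set.mem_ofPred_eq]
      exact ⟨Finset.filter_subset _ _, by rw [(Finset.mem_powersetCard.1 hIl).2]; exact hfar⟩
    · obtain ⟨hjI, hjτ⟩ := Finset.mem_filter.1 hj
      have h3 : √τ ≤ ‖orthComponent v I j‖ := Real.sqrt_le_iff.2 ⟨norm_nonneg _, hjτ⟩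
      have h4 : 0 < ‖orthComponent v I j‖ := (Real.sqrt_pos.2 hτ0).trans_le h3
      have h5 := norm_colProj_mul_norm_orthComponent_le M V hjI (norm_pos_iff.1 h4)
      rw [le_div_iff₀ (Real.sqrt_pos.2 hτ0)]
      calc _ ≤ ‖colProj I M (colVec M j)‖ * ‖orthComponent v I j‖ := by gcongr
        _ ≤ ‖M * Vᵀ‖ := h5
        _ ≤ s := hM
  have hcard : (G.card : ℝ) - X.card ≤ (G \ X).card := by
    have h6 : G.card ≤ (G \ X).card + X.card := by
      have := Finset.le_card_sdiff X G
      omega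
    have : (G.card : ℝ) ≤ (G \ X).card + X.card := by exact_mod_cast h6
    linarith
  -- Since `l ≥ 1`, the exceptional sets take at most half of the guaranteed proportion.
  have h7 : 2 * (η / 32) ^ l ≤ (η / 16) ^ l := by
    have : (2 : ℝ) ≤ 2 ^ l := le_self_pow₀ one_le_two hl.ne'
    calc 2 * (η / 32) ^ l ≤ 2 ^ l * (η / 32) ^ l := by gcongr
      _ = (η / 16) ^ l := by rw [← mul_pow]; ring_nf
  calc (η / 32) ^ l * n.choose l
      ≤ (η / 16) ^ l * n.choose l - (η / 32) ^ l * n.choose l := by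
        have := mul_le_mul_of_nonneg_right h7 (Nat.cast_nonneg (α := ℝ) (n.choose l))
        linarith
    _ ≤ (G.card : ℝ) - X.card := by linarith
    _ ≤ (G \ X).card := hcard
    _ ≤ _ := by exact_mod_cast Finset.card_le_card hsub

theorem proposition7p4 :
    ∃ c₁ c₂ c₃ C : ℝ, 0 < c₁ ∧ 0 < c₂ ∧ 0 < c₃ ∧ 0 < C ∧
      ∀ (n k : ℕ) (η ρ s t : ℝ), 0 < η → 0 < ρ → 1 ≤ ⌊η * n⌋₊ → 0 ≤ s → 0 ≤ t →
      ∀ {Ω : Type*} [MeasurableSpace Ω] (μ : Measure Ω) [IsProbabilityMeasure μ]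
        (B : Ω → Matrix (Fin n) (Fin n) ℂ), Measurable B →
        iIndepFun (fun (j : Fin n) (ω : Ω) => (B ω).col j) μ →
      ∀ l : ℕ, l = ⌊c₁ * η ^ 3 * ρ ^ 2 * k⌋₊ →
      ∀ F : (I : Finset (Fin n)) → Set (Matrix (Fin n) {j : Fin n // j ∉ I} ℂ),
        (∀ I : Finset (Fin n), I.card = l → MeasurableSet (F I)) →
        (∀ I : Finset (Fin n), I.card = l → ∀ j ∈ I,
          ∀ᵐ ω ∂μ, complCols I (B ω) ∈ F I →
            (μ⟦{ω' | ‖colProj I (B ω') (colVec (B ω') j)‖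
                  ≤ √2 / (c₂ * ρ) * √((n : ℝ) / (η * k)) * s} |
                MeasurableSpace.comap (fun ω' => complCols I (B ω')) inferInstance⟧) ω ≤ t) →
        μ.real {ω | (∃ V ∈ spreadMatrices k n η ρ, ‖B ω * Vᵀ‖ ≤ s) ∧
            exceptionalProb l F (B ω) ≤ (c₃ * η / 2) ^ l}
          ≤ (C * √t / η) ^ l := by
  -- The last constant is `2 * 32`: the `2` from the union bound, the `32` from the proportion of
  -- good sets.
  refine ⟨1 / 512, 1 / 2, 1 / 16, 64, by norm_num, by norm_num, by norm_num, by norm_num, ?_⟩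
  intro n k η ρ s t hη hρ hm _ ht Ω _ μ _ B hB hind l hlk F hF hsmall
  classical
  rcases Nat.eq_zero_or_pos l with rfl | hl
  · rw [pow_zero]
    exact measureReal_le_one
  have hlk' : (l : ℝ) ≤ 1 / 512 * η ^ 3 * ρ ^ 2 * k := by
    rw [hlk]
    exact Nat.floor_le (by positivity)
  have hk : 0 < k := by
    rcases Nat.eq_zero_or_pos k with rfl | h
    · simp at hlk; omega
    · exact h
  by_cases hne : ∃ V, V ∈ spreadMatrices k n η ρ
  swap
  · have : {ω | (∃ V ∈ spreadMatrices k n η ρ, ‖B ω * Vᵀ‖ ≤ s) ∧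
        exceptionalProb l F (B ω) ≤ (1 / 16 * η / 2) ^ l} = ∅ := by
      ext ω
      simp only [Set.mem_ofPred_eq, Set.mem_empty_iff_false, iff_false]
      rintro ⟨⟨V, hV, _⟩, _⟩
      exact hne ⟨V, hV⟩
    rw [this, measureReal_empty]
    positivity
  obtain ⟨V₀, hV₀⟩ := hne
  obtain ⟨hn, hkn, -, hη2, hηρ⟩ := spread_parameter_bounds hρ hm hk hV₀
  -- For `t ≥ 1` the bound exceeds `1` because `η ≤ 2`, which relies on a spread matrix existing.
  rcases le_total 1 t with ht1 | ht1
  · refine measureReal_le_one.trans (one_le_pow₀ ?_)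
    have : 1 ≤ √t := Real.one_le_sqrt.2 ht1
    rw [le_div_iff₀ hη]
    linarith
  have hchoose : 0 < n.choose l := by
    refine Nat.choose_pos ?_
    have h1 : η ^ 3 * ρ ^ 2 * k ≤ 8 * (n : ℝ) := by
      have hkn' : (k : ℝ) ≤ n := by exact_mod_cast hkn
      calc η ^ 3 * ρ ^ 2 * (k : ℝ) = η ^ 2 * (η * ρ ^ 2) * k := by ring
        _ ≤ 2 ^ 2 * 2 * (n : ℝ) := by gcongr
        _ = _ := by ring
    have h2 : (l : ℝ) ≤ n := by
      have : (0 : ℝ) ≤ n := n.cast_nonneg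
      linarith
    exact_mod_cast h2
  set r := √2 / (1 / 2 * ρ) * √((n : ℝ) / (η * k)) * s
  set T := {ω | (∃ V ∈ spreadMatrices k n η ρ, ‖B ω * Vᵀ‖ ≤ s) ∧
            exceptionalProb l F (B ω) ≤ (1 / 16 * η / 2) ^ l}
  have hmarkov := measure_mul_le_of_forall_le_card μ
    ((Finset.univ : Finset (Fin n)).powersetCard l)
    (fun I => B ⁻¹' manyShortColumns I (F I) r)
    (fun I hI => hB (measurableSet_manyShortColumns I (hF I (Finset.mem_powersetCard.1 hI).2) r))
    (p := ENNReal.ofReal ((2 * √t) ^ l))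
    (fun I hI => by
      have hIl := (Finset.mem_powersetCard.1 hI).2
      have := measure_manyShortColumns_le hB hind (hF I hIl) ht ht1 (hsmall I hIl)
      rwa [hIl] at this)
    T (ENNReal.ofReal ((η / 32) ^ l * n.choose l))
    (by
      rintro ω ⟨⟨V, hV, hVs⟩, hFω⟩
      have h1 := le_card_manyShortColumns hη hρ hm hV hl hlk' (B ω) hVs F hFω
      refine (ENNReal.ofReal_le_ofReal h1).trans (le_of_eq ?_)
      rw [ENNReal.ofReal_natCast, Finset.card_filter]
      push_cast
      refine Finset.sum_congr rfl fun I _ => ?_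
      simp [Set.indicator_apply, r])
  have hreal := ENNReal.toReal_mono (by finiteness) hmarkov
  rw [ENNReal.toReal_mul, ENNReal.toReal_mul, ENNReal.toReal_ofReal (by positivity),
    ENNReal.toReal_ofReal (by positivity), ENNReal.toReal_natCast, Finset.card_powersetCard,
    Finset.card_univ, Fintype.card_fin] at hreal
  have hch : (0 : ℝ) < n.choose l := by exact_mod_cast hchoose
  have h3 : (η / 32) ^ l * μ.real T ≤ (2 * √t) ^ l := by
    refine le_of_mul_le_mul_left ?_ hch
    calc _ = (η / 32) ^ l * n.choose l * μ.real T := by ring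
      _ ≤ _ := hreal
  rw [mul_comm, ← le_div_iff₀ (by positivity), ← div_pow] at h3
  refine h3.trans (le_of_eq ?_)
  congr 1
  field_simp
  ring
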